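/- Let $G=(V,E)$ be a finite simple graph with $n=|V|$ vertices and let $\zeta:V\to\{1,\dots,n\}$ be a bijective labeling of its vertices. The chromatic quasisymmetric function of $G$ with respect to $\zeta$ is $$\mathbf X_{G,\zeta}(\mathbf x,t)=\sum_{\kappa}t^{\mathrm{asc}(\kappa)}\prod_{v\in V}x_{\kappa(v)},\qquad \mathrm{asc}(\kappa)=\bigl|\{\{u,v\}\in E:\zeta(u)<\zeta(v)\text{ and }\kappa(u)<\kappa(v)\}\bigr|,$$ a formal power series in $x_1,x_2,\dots$ over $\mathbb Z[t]$, where $\kappa$ runs over all proper colorings $\kappa:V\to\{1,2,3,\dots\}$ of $G$. For a composition $\alpha=(\alpha_1,\dots,\alpha_\ell)$ of $m$ let $D(\alpha)=\{\alpha_1,\alpha_1+\alpha_2,\dots,\alpha_1+\cdots+\alpha_{\ell-1}\}$, and let $$F_\alpha=\sum_{\substack{i_1\le\cdots\le i_m\\ i_j=i_{j+1}\Rightarrow j\notin D(\alpha)}}x_{i_1}\cdots x_{i_m}$$ be Gessel's fundamental quasisymmetric function. Then there is exactly one finitely supported family $(d_\alpha(t))_\alpha$ of polynomials in $\mathbb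 Z[t]$, indexed by all compositions $\alpha$, with $$\mathbf X_{G,\zeta}(\mathbf x,t)=\sum_\alpha d_\alpha(t)F_\alpha,$$ and for every $k$ with $1\le k\le n$ its coefficient at the hook $\lambda^{(k)}=(k,1,\dots,1)$ of size $n$ is $$d_{\lambda^{(k)}}(t)=\sum_{\mathfrak o}\binom{\mathrm{snk}(\mathfrak o)-1}{k-1}\,t^{\mathrm{des}(\mathfrak o)}.$$ Here $\mathfrak o$ runs over all acyclic orientations of $G$, $\mathrm{snk}(\mathfrak o)$ is the number of sinks of $\mathfrak o$ (vertices that no arrow leaves, so that isolated vertices are sinks), and $\mathrm{des}(\mathfrak o)$ is the number of directed edges $(u,v)$ of $\mathfrak o$, from $u$ to $v$, with $\zeta(u)>\zeta(v)$. -/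

import Mathlib

namespace ChromaticQSym

noncomputable section

/-- The exponent vector of the monomial `∏ i, x_{f i}` in the variables `x_1, x_2, …`. -/
def exponent {ι : Type*} [Fintype ι] (f : ι → ℕ+) : ℕ+ →₀ ℕ :=
  ∑ i, Finsupp.single (f i) 1

/-- The formal power series `∑ i, w i • x ^ (e i)`, for a family of exponents `e`
each of which is attained only finitely often. -/
def formalSum {ι R : Type*} [CommRing R] (w : ι → R) (e : ι → ℕ+ →₀ ℕ) : MvPowerSeries ℕ+ R :=
  fun m => ∑ᶠ (i : ι) (_ : e i = m), w i

/-- Every monomial is of the form `∏ i, x_{f i}` for only finitely many `f`. -/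
theorem finite_exponent_eq {ι : Type*} [Fintype ι] (m : ℕ+ →₀ ℕ) :
    {f : ι → ℕ+ | exponent f = m}.Finite := by
  classical
  refine (Set.Finite.pi' (fun _ : ι => m.support.finite_toSet)).subset ?_
  rintro f rfl i
  simp only [exponent, Finset.mem_coe, Finsupp.mem_support_iff, Finsupp.finsetSum_apply]
  intro h
  have := (Finset.sum_eq_zero_iff.mp h) i (Finset.mem_univ i)
  simp at this

/-! ### Fundamental quasisymmetric functions -/

/-- The subset of `{1, …, n - 1}` of proper partial sums of the parts of a composition of `n`:
`(i₁, i₂ - i₁, …, n - i_r)` corresponds to `{i₁ < i₂ < … < i_r}`. -/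
def descentSet {n : ℕ} (α : Composition n) : Set ℕ :=
  {j | ∃ l : ℕ, 0 < l ∧ l < α.length ∧ j = α.sizeUpTo l}

/-- The sequences `i₁ ≤ ⋯ ≤ i_n` of positive integers such that `i_j = i_{j+1}` implies that `j`
is not in the descent set of `α`. With indices in `Fin n`, which start at `0`, the pair of
positions `j, j + 1` is `a, b` with `b = j`. -/
def IsFundamentalSeq {n : ℕ} (α : Composition n) (i : Fin n → ℕ+) : Prop :=
  Monotone i ∧ ∀ a b : Fin n, (b : ℕ) = a + 1 → i a = i b → (b : ℕ) ∉ descentSet α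

/-- Gessel's fundamental quasisymmetric function `F_α`. -/
def fundamental (R : Type*) [CommRing R] {n : ℕ} (α : Composition n) : MvPowerSeries ℕ+ R :=
  formalSum (fun _ : {i : Fin n → ℕ+ // IsFundamentalSeq α i} => (1 : R))
    (fun i => exponent i.1)

/-- The sum defining each coefficient of `F_α` is finite. -/
theorem finite_fundamental {n : ℕ} (α : Composition n) (m : ℕ+ →₀ ℕ) :
    {i : {i : Fin n → ℕ+ // IsFundamentalSeq α i} | exponent i.1 = m}.Finite :=
  (finite_exponent_eq m).preimage Subtype.val_injective.injOn

/-- The hook `(k, 1, …, 1)` of size `n`. -/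
def hook (n k : ℕ) (hk : 1 ≤ k) (hkn : k ≤ n) : Composition n where
  blocks := k :: List.replicate (n - k) 1
  blocks_pos := by
    intro i hi
    rcases List.mem_cons.mp hi with rfl | hi
    · exact hk
    · rw [List.eq_of_mem_replicate hi]; exact Nat.one_pos
  blocks_sum := by
    simp only [List.sum_cons, List.sum_replicate, smul_eq_mul, mul_one]
    omega

/-! ### The chromatic quasisymmetric function -/

variable {V : Type*} [Fintype V]

/-- The number of edges `{u, v}` with `ζ u < ζ v` and `κ u < κ v`; each such edge is counted
through its unique ordering `(u, v)` with this property. -/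
def asc (G : SimpleGraph V) (ζ : V ≃ Fin (Fintype.card V)) (κ : G.Coloring ℕ+) : ℕ :=
  {p : V × V | G.Adj p.1 p.2 ∧ ζ p.1 < ζ p.2 ∧ κ p.1 < κ p.2}.ncard

/-- The chromatic quasisymmetric function `∑_κ t ^ asc(κ) x_κ`, the sum over all proper
colorings `κ` by positive integers, as a power series over `ℤ[t]`. -/
def chromatic (G : SimpleGraph V) (ζ : V ≃ Fin (Fintype.card V)) :
    MvPowerSeries ℕ+ (Polynomial ℤ) :=
  formalSum (fun κ : G.Coloring ℕ+ => (Polynomial.X : Polynomial ℤ) ^ asc G ζ κ)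
    (fun κ => exponent κ)

/-- The sum defining each coefficient of the chromatic quasisymmetric function is finite. -/
theorem finite_chromatic (G : SimpleGraph V) (m : ℕ+ →₀ ℕ) :
    {κ : G.Coloring ℕ+ | exponent κ = m}.Finite :=
  (finite_exponent_eq m).preimage DFunLike.coe_injective.injOn

/-! ### Acyclic orientations -/

/-- An acyclic orientation of a graph: each edge carries exactly one of its two directions, and
there is no directed cycle. -/
@[ext]
structure AcyclicOrientation (G : SimpleGraph V) where
  /-- `arrow u v` means that `{u, v}` is an edge directed from `u` to `v`. -/
  arrow : V → V → Prop
  adj_iff : ∀ u v, G.Adj u v ↔ arrow u v ∨ arrow v u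
  asymm : ∀ u v, arrow u v → ¬ arrow v u
  acyclic : ∀ u, ¬ Relation.TransGen arrow u u

instance (G : SimpleGraph V) : Finite (AcyclicOrientation G) :=
  Finite.of_injective AcyclicOrientation.arrow fun _ _ h => AcyclicOrientation.ext h

instance (G : SimpleGraph V) : Fintype (AcyclicOrientation G) :=
  Fintype.ofFinite _

/-- The number of sinks: vertices that no arrow leaves. -/
def AcyclicOrientation.snk {G : SimpleGraph V} (o : AcyclicOrientation G) : ℕ :=
  {v : V | ∀ w, ¬ o.arrow v w}.ncard

/-- The number of directed edges `(u, v)` with `ζ u > ζ v`. -/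
def AcyclicOrientation.des {G : SimpleGraph V} (o : AcyclicOrientation G)
    (ζ : V ≃ Fin (Fintype.card V)) : ℕ :=
  {p : V × V | o.arrow p.1 p.2 ∧ ζ p.1 > ζ p.2}.ncard

end

end ChromaticQSym

namespace ChromaticQSym

noncomputable section

open Finset Polynomial

/-! ### Sequences indexed by `Fin n` -/

/-! This is Stanley's theory of P-partitions. A proper coloring orients each edge towards the
smaller color, and `asc` becomes `des`. Give each acyclic orientation a labeling ω that increases
along its arrows, and sort the vertices by (color, ω). This yields a linear extension w (heads
before tails) and a weakly increasing color sequence, strict wherever ω descends along w. The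
process is reversible (`FundamentalDatum.coloring_bijective`), so the chromatic function is the sum
of `t ^ des` times the fundamental function of the descent composition, over all pairs of an
orientation and a linear extension (`chromatic_eq_sum`).

Uniqueness of the coefficients is `linearIndependent_fundamental`, a triangularity argument.

For a hook, w must have ω increasing on its first k entries and decreasing afterwards, so w is
determined by the set A of those entries. Being increasing forces A to consist of sinks, and the
peak forces A to contain the vertex of largest label, itself a sink. Conversely every such A occurs,
which gives the binomial coefficient (`AcyclicOrientation.card_linearExtensions_hook`). -/

theorem strictMono_of_adjacent {n : ℕ} {L : Type*} [Preorder L] {f : Fin n → L}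
    (h : ∀ a b : Fin n, (b : ℕ) = a + 1 → f a < f b) : StrictMono f := by
  cases n with
  | zero => exact fun a => a.elim0
  | succ n => exact Fin.strictMono_iff_lt_succ.2 fun i => h _ _ (by simp)

/-- The elements of a finite type can be listed in increasing order of an injective key. -/
theorem exists_strictMono_comp {V L : Type*} [Fintype V] [LinearOrder L] {K : V → L}
    (hK : Function.Injective K) : ∃ w : Fin (Fintype.card V) ≃ V, StrictMono (K ∘ w) := by
  let : LinearOrder V := LinearOrder.lift' K hK
  exact ⟨(monoEquivOfFin V rfl).toEquiv, fun a b h => (monoEquivOfFin V rfl).strictMono h⟩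

theorem eq_of_strictMono_comp {V L : Type*} {n : ℕ} [LinearOrder L] {K : V → L}
    (hK : Function.Injective K) {w w' : Fin n ≃ V} (h : StrictMono (K ∘ w))
    (h' : StrictMono (K ∘ w')) : w = w' := by
  have : K ∘ w = K ∘ w' := (StrictMono.range_inj h h').1 (by
    rw [Set.range_comp, Set.range_comp, w.range_eq_univ, w'.range_eq_univ])
  exact Equiv.ext fun i => hK (congrFun this i)

theorem exponent_comp_equiv {ι ι' : Type*} [Fintype ι] [Fintype ι'] (f : ι → ℕ+) (e : ι' ≃ ι) :
    exponent (f ∘ e) = exponent f :=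
  Equiv.sum_comp e fun i => Finsupp.single (f i) 1

theorem degree_exponent {ι : Type*} [Fintype ι] (f : ι → ℕ+) :
    (exponent f).degree = Fintype.card ι := by
  simp [exponent, map_sum]

theorem toMultiset_exponent {ι : Type*} [Fintype ι] (f : ι → ℕ+) :
    Finsupp.toMultiset (exponent f) = univ.val.map f := by
  simp only [exponent, map_sum, Finsupp.toMultiset_single, one_smul]
  rw [← Multiset.sum_map_singleton (univ.val.map f), Multiset.map_map]
  rfl

/-- A weakly increasing sequence is determined by its monomial. -/
theorem Monotone.eq_of_exponent_eq {n : ℕ} {f g : Fin n → ℕ+} (hf : Monotone f) (hg : Monotone g)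
    (h : exponent f = exponent g) : f = g := by
  have h := congrArg Finsupp.toMultiset h
  rw [toMultiset_exponent, toMultiset_exponent, Fin.univ_val_map, Fin.univ_val_map,
    Multiset.coe_eq_coe] at h
  exact List.ofFn_injective (h.eq_of_sortedLE hf.sortedLE_ofFn hg.sortedLE_ofFn)

/-! ### Descent sets of compositions -/

theorem mem_descentSet_iff {n : ℕ} (α : Composition n) (j : ℕ) :
    j ∈ descentSet α ↔ 0 < j ∧ ∃ h : j < n, (⟨j, by omega⟩ : Fin (n + 1)) ∈ α.boundaries := by
  have lt_iff {a b : Fin (α.length + 1)} : α.sizeUpTo a < α.sizeUpTo b ↔ a < b :=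
    α.boundary.lt_iff_lt (a := a) (b := b)
  have h0 := α.sizeUpTo_zero
  have hlast := α.sizeUpTo_length
  constructor
  · rintro ⟨l, hl, hl', rfl⟩
    have h1 := (lt_iff (a := 0) (b := ⟨l, by omega⟩)).2 hl
    have h2 := (lt_iff (a := ⟨l, by omega⟩) (b := Fin.last _)).2 hl'
    simp only [Fin.val_zero, Fin.val_last, h0, hlast] at h1 h2
    exact ⟨h1, h2, mem_map.2 ⟨⟨l, by omega⟩, mem_univ _, rfl⟩⟩
  · rintro ⟨hj, hjn, h⟩
    obtain ⟨l, -, hl⟩ := mem_map.1 h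
    have hl : α.sizeUpTo l = j := congrArg Fin.val hl
    refine ⟨l, ?_, ?_, hl.symm⟩
    · exact (lt_iff (a := 0)).1 (by simpa [h0, hl] using hj)
    · exact (lt_iff (b := Fin.last _)).1 (by simpa [hlast, hl] using hjn)

theorem descentSet_injective {n : ℕ} :
    Function.Injective (descentSet : Composition n → Set ℕ) := by
  intro α β h
  apply (compositionEquiv n).injective
  have key : ∀ j : Fin (n + 1), j ∈ α.boundaries ↔ j ∈ β.boundaries := by
    intro j
    rcases Nat.eq_zero_or_pos j with h0 | h0
    · obtain rfl : j = 0 := Fin.ext h0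
      exact iff_of_true α.toCompositionAsSet.zero_mem β.toCompositionAsSet.zero_mem
    rcases lt_or_ge (j : ℕ) n with hn | hn
    · have := Set.ext_iff.1 h j
      rw [mem_descentSet_iff, mem_descentSet_iff] at this
      simpa [h0, hn] using this
    · obtain rfl : j = Fin.last n := Fin.ext (by have := j.2; simp; omega)
      exact iff_of_true α.toCompositionAsSet.getLast_mem β.toCompositionAsSet.getLast_mem
  exact CompositionAsSet.ext (Finset.ext key)

open Classical in
/-- The composition of `n` with a prescribed descent set. -/
def ofDescentSet (n : ℕ) (S : Set ℕ) : Composition n :=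
  CompositionAsSet.toComposition
    { boundaries := univ.filter fun j => (j : ℕ) = 0 ∨ (j : ℕ) = n ∨ (j : ℕ) ∈ S
      zero_mem := by simp
      getLast_mem := by simp }

theorem mem_descentSet_ofDescentSet {n : ℕ} {S : Set ℕ} {j : ℕ} :
    j ∈ descentSet (ofDescentSet n S) ↔ 0 < j ∧ j < n ∧ j ∈ S := by
  rw [mem_descentSet_iff, ofDescentSet, CompositionAsSet.toComposition_boundaries]
  simp only [mem_filter, mem_univ, true_and, exists_prop]
  constructor
  · rintro ⟨h0, hn, h | h | h⟩
    · omega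
    · omega
    · exact ⟨h0, hn, h⟩
  · rintro ⟨h0, hn, h⟩
    exact ⟨h0, hn, Or.inr (Or.inr h)⟩

theorem mem_descentSet_hook {n k : ℕ} (hk : 1 ≤ k) (hkn : k ≤ n) {j : ℕ} :
    j ∈ descentSet (hook n k hk hkn) ↔ k ≤ j ∧ j < n := by
  have size (l : ℕ) (hl : l ≤ n - k) : (hook n k hk hkn).sizeUpTo (l + 1) = k + l := by
    simp [Composition.sizeUpTo, hook, List.take_replicate, hl]
  have len : (hook n k hk hkn).length = n - k + 1 := by
    simp [Composition.length, hook]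
  constructor
  · rintro ⟨l, hl, hl', rfl⟩
    obtain ⟨l, rfl⟩ := Nat.exists_eq_succ_of_ne_zero hl.ne'
    rw [len] at hl'
    rw [Nat.succ_eq_add_one, size l (by omega)]
    omega
  · rintro ⟨h1, h2⟩
    refine ⟨j - k + 1, by omega, by omega, ?_⟩
    rw [size _ (by omega)]
    omega

/-! ### Linear independence of the fundamental quasisymmetric functions -/

/-- The weakly increasing sequence of positive integers starting at `1` or `2` that increases by
one exactly at the positions of the descent set of `α`. -/
def canonicalSeq {n : ℕ} (α : Composition n) (i : Fin n) : ℕ+ := by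
  classical
  exact Nat.succPNat ((range (i + 1)).filter (· ∈ descentSet α)).card

theorem canonicalSeq_monotone {n : ℕ} (α : Composition n) : Monotone (canonicalSeq α) := by
  classical
  intro a b h
  refine Nat.succPNat_le_succPNat.2 (card_le_card (filter_subset_filter _ ?_))
  exact range_subset_range.2 (by have : (a : ℕ) ≤ b := h; omega)

theorem canonicalSeq_eq_iff {n : ℕ} (α : Composition n) {a b : Fin n} (h : (b : ℕ) = a + 1) :
    canonicalSeq α a = canonicalSeq α b ↔ (b : ℕ) ∉ descentSet α := by
  classical
  rw [canonicalSeq, canonicalSeq, Nat.succPNat_inj, range_add_one (n := b), filter_insert, h]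
  split_ifs with hb <;> simp [hb]

/-- The canonical sequence of α is constant across every position outside the descent set of α, so a
β with a descent there rejects it. This is the triangularity behind linear independence. -/
theorem isFundamentalSeq_canonicalSeq_iff {n : ℕ} (α β : Composition n) :
    IsFundamentalSeq β (canonicalSeq α) ↔ descentSet β ⊆ descentSet α := by
  constructor
  · rintro ⟨-, h⟩ j hj
    obtain ⟨h0, hn, -⟩ := (mem_descentSet_iff β j).1 hj
    by_contra hjα
    have hab : ((⟨j, hn⟩ : Fin n) : ℕ) = ((⟨j - 1, by omega⟩ : Fin n) : ℕ) + 1 := by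
      simp; omega
    exact h _ _ hab ((canonicalSeq_eq_iff α hab).2 hjα) hj
  · exact fun h => ⟨canonicalSeq_monotone α, fun a b hab e hb =>
      (canonicalSeq_eq_iff α hab).1 e (h hb)⟩

theorem fundamental_canonicalSeq_self (R : Type*) [CommRing R] {n : ℕ} (α : Composition n) :
    fundamental R α (exponent (canonicalSeq α)) = 1 := by
  have hα : IsFundamentalSeq α (canonicalSeq α) :=
    (isFundamentalSeq_canonicalSeq_iff α α).2 subset_rfl
  rw [fundamental, formalSum, finsum_eq_single _ ⟨_, hα⟩]
  · simp
  · rintro ⟨i, hi⟩ hne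
    have : IsEmpty (exponent i = exponent (canonicalSeq α)) :=
      ⟨fun h => hne (Subtype.ext (Monotone.eq_of_exponent_eq hi.1 hα.1 h))⟩
    exact finsum_of_isEmpty _

theorem eq_and_subset_of_fundamental_ne_zero (R : Type*) [CommRing R] {n m : ℕ} (α : Composition n)
    (β : Composition m) (h : fundamental R β (exponent (canonicalSeq α)) ≠ 0) :
    m = n ∧ descentSet β ⊆ descentSet α := by
  obtain ⟨⟨i, hi⟩, h, -⟩ := exists_ne_zero_of_finsum_mem_ne_zero h
  have h : exponent i = exponent (canonicalSeq α) := h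
  have hmn := congrArg Finsupp.degree h
  rw [degree_exponent, degree_exponent, Fintype.card_fin, Fintype.card_fin] at hmn
  subst hmn
  refine ⟨rfl, (isFundamentalSeq_canonicalSeq_iff α β).1 ?_⟩
  rwa [← Monotone.eq_of_exponent_eq hi.1 (canonicalSeq_monotone α) h]

theorem linearIndependent_fundamental (R : Type*) [CommRing R] :
    LinearIndependent R fun α : Σ n : ℕ, Composition n => fundamental R α.2 := by
  rw [linearIndependent_iff]
  intro l hl
  by_contra hne
  -- At the canonical monomial of an α with minimal descent set in the support, no other term of the
  -- relation contributes: the degree fixes the size, and minimality fixes the descent set.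
  obtain ⟨α, hα, hmin⟩ := exists_minimalFor (fun α : Σ n : ℕ, Composition n => descentSet α.2)
    l.support (Finsupp.support_nonempty_iff.2 hne)
  have h := congrArg (MvPowerSeries.coeff (exponent (canonicalSeq α.2))) hl
  rw [Finsupp.linearCombination_apply, Finsupp.sum, map_sum, map_zero, sum_eq_single α] at h
  · rw [map_smul, MvPowerSeries.coeff_apply, fundamental_canonicalSeq_self, smul_eq_mul,
      mul_one] at h
    exact Finsupp.mem_support_iff.1 hα h
  · intro β hβ hβα
    rw [map_smul, MvPowerSeries.coeff_apply]
    by_contra hne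
    obtain ⟨n, α⟩ := α
    obtain ⟨m, β⟩ := β
    obtain ⟨rfl, hsub⟩ := eq_and_subset_of_fundamental_ne_zero R α β (right_ne_zero_of_smul hne)
    exact hβα (congrArg _ (descentSet_injective (hsub.antisymm (hmin hβ hsub))))
  · exact fun h => absurd hα h

/-! ### Formal sums -/

theorem formalSum_comp_equiv {ι ι' R : Type*} [CommRing R] (f : ι' ≃ ι) (w : ι → R)
    (e : ι → ℕ+ →₀ ℕ) : formalSum (w ∘ f) (e ∘ f) = formalSum w e :=
  funext fun m => finsum_comp_equiv f (f := fun i => ∑ᶠ (_ : e i = m), w i)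

/-- Finiteness of the fibers is essential: `finsum` takes the value 0 on infinite supports and is
not additive there. -/
theorem formalSum_sigma {P R : Type*} [Fintype P] [CommRing R] {I : P → Type*} (w : P → R)
    (e : ∀ p, I p → ℕ+ →₀ ℕ) (he : ∀ p m, {i | e p i = m}.Finite) :
    formalSum (fun x : Σ p, I p => w x.1) (fun x => e x.1 x.2) =
      ∑ p, w p • formalSum (fun _ => (1 : R)) (e p) := by
  classical
  ext m
  rw [map_sum]
  simp only [map_smul, MvPowerSeries.coeff_apply]
  have hsigma : {x : Σ p, I p | e x.1 x.2 = m} =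
      (univ.sigma fun p => (he p m).toFinset : Finset (Σ p, I p)) := by
    ext x
    simp
  calc ∑ᶠ x ∈ {x : Σ p, I p | e x.1 x.2 = m}, w x.1
      = ∑ p, ∑ i ∈ (he p m).toFinset, w p := by
        rw [hsigma, finsum_mem_coe_finset, sum_sigma]
    _ = ∑ p, w p • ∑ᶠ i ∈ {i | e p i = m}, (1 : R) := by
        refine sum_congr rfl fun p _ => ?_
        rw [finsum_mem_eq_finite_toFinset_sum _ (he p m), smul_sum]
        simp

variable {V : Type*} {G : SimpleGraph V}

/-! ### Descents along a listing of the vertices -/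

/-- The composition of the descents of the labels along a listing of the vertices. -/
def descentComposition {n : ℕ} (ω : V ≃ Fin n) (w : Fin n ≃ V) : Composition n :=
  ofDescentSet n {j | ∃ a b : Fin n, (b : ℕ) = a + 1 ∧ j = b ∧ ω (w b) < ω (w a)}

theorem mem_descentSet_descentComposition {n : ℕ} {ω : V ≃ Fin n} {w : Fin n ≃ V} {a b : Fin n}
    (h : (b : ℕ) = a + 1) :
    (b : ℕ) ∈ descentSet (descentComposition ω w) ↔ ω (w b) < ω (w a) := by
  rw [descentComposition, mem_descentSet_ofDescentSet]
  constructor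
  · rintro ⟨-, -, a', b', h1, h2, h3⟩
    obtain rfl : b = b' := Fin.ext h2
    obtain rfl : a = a' := Fin.ext (by omega)
    exact h3
  · exact fun h' => ⟨by omega, b.2, a, b, h, rfl, h'⟩

theorem descentComposition_eq_hook_iff {n k : ℕ} (hk : 1 ≤ k) (hkn : k ≤ n) {ω : V ≃ Fin n}
    {w : Fin n ≃ V} :
    descentComposition ω w = hook n k hk hkn ↔
      ∀ a b : Fin n, (b : ℕ) = a + 1 → (ω (w b) < ω (w a) ↔ k ≤ b) := by
  rw [← descentSet_injective.eq_iff]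
  constructor
  · intro h a b hab
    rw [← mem_descentSet_descentComposition hab, h, mem_descentSet_hook]
    exact and_iff_left b.2
  · intro h
    ext j
    rw [mem_descentSet_hook]
    by_cases hj : 0 < j ∧ j < n
    · have hab : ((⟨j, hj.2⟩ : Fin n) : ℕ) = ((⟨j - 1, by omega⟩ : Fin n) : ℕ) + 1 := by
        simp; omega
      rw [and_iff_left hj.2]
      exact (mem_descentSet_descentComposition hab).trans (h _ _ hab)
    · refine iff_of_false (fun h => hj ?_) (by omega)
      obtain ⟨h0, hn, -⟩ := (mem_descentSet_iff _ j).1 h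
      exact ⟨h0, hn⟩

/-! ### Sorting keys -/

/-- The keys by which the linear extension attached to a coloring sorts the vertices. -/
def colorKey {n : ℕ} (κ : V → ℕ+) (ω : V ≃ Fin n) (v : V) : ℕ+ ×ₗ Fin n :=
  toLex (κ v, ω v)

theorem colorKey_injective {n : ℕ} (κ : V → ℕ+) (ω : V ≃ Fin n) :
    Function.Injective (colorKey κ ω) := fun _ _ h =>
  ω.injective (Prod.ext_iff.1 (toLex.injective h)).2

/-- Between neighbors of the listing, a tie in color is allowed exactly when ω ascends, which is the
lexicographic comparison of keys. Hence w is recovered from κ by sorting. -/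
theorem isFundamentalSeq_iff_strictMono {n : ℕ} {ω : V ≃ Fin n} {w : Fin n ≃ V} {κ : V → ℕ+} :
    IsFundamentalSeq (descentComposition ω w) (κ ∘ w) ↔ StrictMono (colorKey κ ω ∘ w) := by
  constructor
  · rintro ⟨hmono, h⟩
    refine strictMono_of_adjacent fun a b hab => Prod.Lex.toLex_lt_toLex.2 ?_
    have hle : a ≤ b := Fin.le_def.2 (by omega)
    refine (hmono hle).lt_or_eq.imp_right fun he => ⟨he, lt_of_le_of_ne ?_ fun h' => ?_⟩
    · have := h a b hab he
      rwa [mem_descentSet_descentComposition hab, not_lt] at this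
    · rw [w.injective (ω.injective h')] at hab
      omega
  · intro h
    refine ⟨fun a b hab => (Prod.Lex.toLex_le_toLex'.1 (h.monotone hab)).1, fun a b hab he => ?_⟩
    rw [mem_descentSet_descentComposition hab, not_lt]
    exact (Prod.Lex.toLex_le_toLex'.1 (h.monotone (Fin.le_def.2 (by omega)))).2 he

open Classical in
/-- The keys by which the linear extension attached to a set of sinks sorts the vertices: first
the vertices of `A` by increasing label, then the others by decreasing label. -/
def hookKey {n : ℕ} (ω : V ≃ Fin n) (A : Finset V) (v : V) : ℕ :=
  if v ∈ A then ω v else 2 * n - ω v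

theorem hookKey_of_mem {n : ℕ} (ω : V ≃ Fin n) {A : Finset V} {v : V} (h : v ∈ A) :
    hookKey ω A v = ω v :=
  if_pos h

theorem hookKey_of_notMem {n : ℕ} (ω : V ≃ Fin n) {A : Finset V} {v : V} (h : v ∉ A) :
    hookKey ω A v = 2 * n - ω v :=
  if_neg h

theorem hookKey_injective {n : ℕ} (ω : V ≃ Fin n) (A : Finset V) :
    Function.Injective (hookKey ω A) := by
  intro u v h
  have hu := (ω u).2
  have hv := (ω v).2
  unfold hookKey at h
  refine ω.injective (Fin.ext ?_)
  split_ifs at h <;> omega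

theorem symm_lt_iff_mem_of_strictMono_hookKey {n : ℕ} {ω : V ≃ Fin n} {w : Fin n ≃ V}
    {A : Finset V} (h : StrictMono (hookKey ω A ∘ w)) (v : V) :
    (w.symm v : ℕ) < #A ↔ v ∈ A := by
  classical
  have key {a b : Fin n} (hab : a < b) (hb : w b ∈ A) : w a ∈ A := by
    by_contra ha
    have := h hab
    simp only [Function.comp_apply, hookKey_of_mem ω hb, hookKey_of_notMem ω ha] at this
    omega
  obtain ⟨j, rfl⟩ := w.surjective v
  rw [Equiv.symm_apply_apply]
  constructor
  · contrapose!
    intro hj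
    calc #A ≤ #((Iio j).map w.toEmbedding) := card_le_card fun u hu => by
          rw [mem_map_equiv, mem_Iio]
          by_contra hlt
          rcases (not_lt.1 hlt).lt_or_eq with hlt | rfl
          · exact hj (key hlt (by simpa using hu))
          · exact hj (by simpa using hu)
      _ = j := by simp
  · intro hj
    calc (j : ℕ) < #((Iic j).map w.toEmbedding) := by simp
      _ ≤ #A := card_le_card fun u hu => by
          rw [mem_map_equiv, mem_Iic] at hu
          rcases hu.lt_or_eq with hlt | rfl
          · simpa using key hlt hj
          · simpa using hj

/-! ### Linear extensions of acyclic orientations -/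

/-- The acyclic orientation of the edges towards the smaller color. -/
def orientationOfColoring (κ : G.Coloring ℕ+) : AcyclicOrientation G where
  arrow u v := G.Adj u v ∧ κ v < κ u
  adj_iff u v := by
    constructor
    · intro h
      rcases lt_or_gt_of_ne (κ.valid h) with h' | h'
      · exact Or.inr ⟨h.symm, h'⟩
      · exact Or.inl ⟨h, h'⟩
    · rintro (h | h)
      · exact h.1
      · exact h.1.symm
  asymm u v h h' := h.2.asymm h'.2
  acyclic u h := by
    have key : ∀ v, Relation.TransGen (fun u v => G.Adj u v ∧ κ v < κ u) u v → κ v < κ u := by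
      intro v h
      induction h with
      | single h => exact h.2
      | tail _ h ih => exact h.2.trans ih
    exact (key u h).false

theorem AcyclicOrientation.eq_orientationOfColoring {o : AcyclicOrientation G} {κ : G.Coloring ℕ+}
    (h : ∀ u v, o.arrow u v → κ v < κ u) : o = orientationOfColoring κ := by
  ext u v
  refine ⟨fun huv => ⟨(o.adj_iff u v).2 (Or.inl huv), h u v huv⟩, fun huv => ?_⟩
  rcases (o.adj_iff u v).1 huv.1 with h' | h'
  · exact h'
  · exact absurd huv.2 (h v u h').not_gt

variable [Fintype V]

theorem AcyclicOrientation.exists_labeling (o : AcyclicOrientation G) :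
    ∃ ω : V ≃ Fin (Fintype.card V), ∀ u v, o.arrow u v → ω u < ω v := by
  let : PartialOrder V :=
    { le := Relation.ReflTransGen o.arrow
      le_refl := fun _ => .refl
      le_trans := fun _ _ _ => .trans
      le_antisymm := fun u v h h' => by
        rcases Relation.reflTransGen_iff_eq_or_transGen.1 h with rfl | h
        · rfl
        · exact absurd (h.trans_left h') (o.acyclic u) }
  have inj : Function.Injective (toLinearExtension : V →o LinearExtension V) := fun _ _ h => h
  obtain ⟨w, hw⟩ := exists_strictMono_comp inj
  refine ⟨w.symm, fun u v h => hw.lt_iff_lt.1 ?_⟩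
  have hne : u ≠ v := by
    rintro rfl
    exact o.acyclic u (.single h)
  simpa using (toLinearExtension.monotone (Relation.ReflTransGen.single h : u ≤ v)).lt_of_ne
    (inj.ne hne)

/-- A labeling of the vertices that increases along the arrows. -/
def AcyclicOrientation.labeling (o : AcyclicOrientation G) : V ≃ Fin (Fintype.card V) :=
  o.exists_labeling.choose

theorem AcyclicOrientation.labeling_lt (o : AcyclicOrientation G) {u v : V} (h : o.arrow u v) :
    o.labeling u < o.labeling v :=
  o.exists_labeling.choose_spec u v h

open Classical in
/-- The listings of the vertices in which the head of each arrow comes before its tail. -/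
def AcyclicOrientation.linearExtensions (o : AcyclicOrientation G) :
    Finset (Fin (Fintype.card V) ≃ V) :=
  univ.filter fun w => ∀ u v, o.arrow u v → w.symm v < w.symm u

theorem AcyclicOrientation.mem_linearExtensions {o : AcyclicOrientation G}
    {w : Fin (Fintype.card V) ≃ V} :
    w ∈ o.linearExtensions ↔ ∀ u v, o.arrow u v → w.symm v < w.symm u := by
  simp [linearExtensions]

/-! ### Expansion of the chromatic quasisymmetric function -/

/-- The head v precedes u in w but has the larger label, so the lexicographic order cannot be
decided by a tie in color. This is why the labeling increases along arrows while linear extensions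
list heads first. -/
theorem AcyclicOrientation.color_lt {o : AcyclicOrientation G} {w : Fin (Fintype.card V) ≃ V}
    (hw : w ∈ o.linearExtensions) {κ : V → ℕ+} (hκ : StrictMono (colorKey κ o.labeling ∘ w))
    {u v : V} (h : o.arrow u v) : κ v < κ u := by
  have := hκ (mem_linearExtensions.1 hw u v h)
  simp only [Function.comp_apply, Equiv.apply_symm_apply] at this
  rcases Prod.Lex.toLex_lt_toLex.1 this with h' | ⟨-, h'⟩
  · exact h'
  · exact absurd h' (o.labeling_lt h).not_gt

theorem asc_eq_des (ζ : V ≃ Fin (Fintype.card V)) (κ : G.Coloring ℕ+) :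
    asc G ζ κ = (orientationOfColoring κ).des ζ := by
  rw [asc, AcyclicOrientation.des, ← Set.ncard_image_of_injective _ Prod.swap_injective]
  congr 1
  ext ⟨u, v⟩
  simp only [Set.image_swap_eq_preimage_swap, Set.mem_preimage, Set.mem_ofPred_eq, Prod.fst_swap,
    Prod.snd_swap, orientationOfColoring, G.adj_comm v u]
  tauto

/-- An acyclic orientation together with one of its linear extensions. -/
abbrev OrientedListing (G : SimpleGraph V) :=
  Σ o : AcyclicOrientation G, o.linearExtensions

/-- The composition attached to a linear extension of an acyclic orientation. -/
def OrientedListing.composition (p : OrientedListing G) : Composition (Fintype.card V) :=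
  descentComposition p.1.labeling p.2.1

/-- The fundamental sequences of all linear extensions. -/
abbrev FundamentalDatum (G : SimpleGraph V) :=
  Σ p : OrientedListing G, {i : Fin (Fintype.card V) → ℕ+ // IsFundamentalSeq p.composition i}

theorem FundamentalDatum.strictMono (x : FundamentalDatum G) :
    StrictMono (colorKey (x.2.1 ∘ x.1.2.1.symm) x.1.1.labeling ∘ x.1.2.1) := by
  rw [← isFundamentalSeq_iff_strictMono, Function.comp_assoc, Equiv.symm_comp_self]
  exact x.2.2

theorem FundamentalDatum.color_lt (x : FundamentalDatum G) {u v : V} (h : x.1.1.arrow u v) :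
    x.2.1 (x.1.2.1.symm v) < x.2.1 (x.1.2.1.symm u) :=
  AcyclicOrientation.color_lt x.1.2.2 x.strictMono h

/-- The proper coloring given by a fundamental sequence of a linear extension. -/
def FundamentalDatum.coloring (x : FundamentalDatum G) : G.Coloring ℕ+ :=
  SimpleGraph.Coloring.mk (x.2.1 ∘ x.1.2.1.symm) fun {u v} h => by
    rcases (x.1.1.adj_iff u v).1 h with h | h
    · exact (x.color_lt h).ne'
    · exact (x.color_lt h).ne

theorem FundamentalDatum.coe_coloring (x : FundamentalDatum G) :
    ⇑x.coloring = x.2.1 ∘ x.1.2.1.symm :=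
  rfl

theorem FundamentalDatum.orientation_eq (x : FundamentalDatum G) :
    x.1.1 = orientationOfColoring x.coloring :=
  AcyclicOrientation.eq_orientationOfColoring fun _ _ => x.color_lt

theorem FundamentalDatum.coloring_bijective :
    Function.Bijective (FundamentalDatum.coloring : FundamentalDatum G → G.Coloring ℕ+) := by
  constructor
  · intro x y h
    have hx := x.strictMono
    have hy := y.strictMono
    -- The coloring determines the orientation, hence the labeling, hence by sorting the listing,
    -- and finally the sequence.
    have ho : x.1.1 = y.1.1 := by rw [x.orientation_eq, y.orientation_eq, h]
    have h' := congrArg DFunLike.coe h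
    rw [coe_coloring, coe_coloring] at h'
    rw [h'] at hx
    obtain ⟨⟨o, w, hw⟩, i, hi⟩ := x
    obtain ⟨⟨o', w', hw'⟩, i', hi'⟩ := y
    obtain rfl : o = o' := ho
    obtain rfl : w = w' := eq_of_strictMono_comp (colorKey_injective _ _) hx hy
    obtain rfl : i = i' := w.symm.surjective.injective_comp_right h'
    rfl
  · intro κ
    set o := orientationOfColoring κ with ho
    obtain ⟨w, hw⟩ := exists_strictMono_comp (colorKey_injective κ o.labeling)
    have hwo : w ∈ o.linearExtensions := by
      refine AcyclicOrientation.mem_linearExtensions.2 fun u v h => hw.lt_iff_lt.1 ?_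
      simp only [Function.comp_apply, Equiv.apply_symm_apply]
      exact Prod.Lex.toLex_lt_toLex.2 (Or.inl h.2)
    refine ⟨⟨⟨o, w, hwo⟩, κ ∘ w, isFundamentalSeq_iff_strictMono.2 hw⟩, ?_⟩
    refine DFunLike.coe_injective ?_
    rw [coe_coloring, Function.comp_assoc, Equiv.self_comp_symm, Function.comp_id]

theorem chromatic_eq_sum (G : SimpleGraph V) (ζ : V ≃ Fin (Fintype.card V)) :
    chromatic G ζ = ∑ p : OrientedListing G,
      (X : ℤ[X]) ^ p.1.des ζ • fundamental ℤ[X] p.composition := by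
  rw [chromatic, ← formalSum_comp_equiv
    (Equiv.ofBijective _ (FundamentalDatum.coloring_bijective (G := G)))]
  refine Eq.trans ?_ (formalSum_sigma (fun p : OrientedListing G => (X : ℤ[X]) ^ p.1.des ζ)
    (fun p (i : {i // IsFundamentalSeq p.composition i}) => exponent i.1)
    fun p m => finite_fundamental _ m)
  congr 1
  · funext x
    simp only [Function.comp_apply, Equiv.ofBijective_apply, asc_eq_des, ← x.orientation_eq]
  · funext x
    exact exponent_comp_equiv _ x.1.2.1.symm

/-! ### Linear extensions with hook descent composition -/

open Classical in
theorem card_filter_mem_powersetCard {α : Type*} {s : Finset α} {a : α} (ha : a ∈ s) {k : ℕ}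
    (hk : 1 ≤ k) : #{A ∈ s.powersetCard k | a ∈ A} = (#s - 1).choose (k - 1) := by
  rw [← card_erase_of_mem ha, ← card_powersetCard]
  refine card_nbij' (fun A => A.erase a) (fun A => insert a A) ?_ ?_ ?_ ?_
  · intro A hA
    simp only [coe_filter, mem_powersetCard, Set.mem_ofPred_eq, mem_coe] at hA ⊢
    exact ⟨erase_subset_erase a hA.1.1, by rw [card_erase_of_mem hA.2, hA.1.2]⟩
  · intro A hA
    simp only [coe_filter, mem_powersetCard, Set.mem_ofPred_eq, mem_coe] at hA ⊢
    have haA : a ∉ A := fun h => notMem_erase a s (hA.1 h)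
    refine ⟨⟨insert_subset ha (hA.1.trans (erase_subset a s)), ?_⟩, mem_insert_self a A⟩
    rw [card_insert_of_notMem haA, hA.2]
    omega
  · intro A hA
    exact insert_erase (mem_filter.1 hA).2
  · intro A hA
    exact erase_insert fun h => notMem_erase a s ((mem_powersetCard.1 hA).1 h)

theorem strictMono_hookKey {n k : ℕ} {ω : V ≃ Fin n} {w : Fin n ≃ V}
    (h : ∀ a b : Fin n, (b : ℕ) = a + 1 → (ω (w b) < ω (w a) ↔ k ≤ b)) :
    StrictMono (hookKey ω (univ.filter fun v => (w.symm v : ℕ) < k) ∘ w) := by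
  refine strictMono_of_adjacent fun a b hab => ?_
  have ha := (ω (w a)).2
  have hb := (ω (w b)).2
  have hne : (ω (w a) : ℕ) ≠ ω (w b) := fun h => by
    rw [w.injective (ω.injective (Fin.ext h))] at hab
    omega
  have h := h a b hab
  rw [Fin.lt_def] at h
  simp only [Function.comp_apply, hookKey, mem_filter, mem_univ, Equiv.symm_apply_apply, true_and]
  split_ifs <;> omega

open Classical in
theorem AcyclicOrientation.card_linearExtensions_hook (o : AcyclicOrientation G) {k : ℕ}
    (hk : 1 ≤ k) (hkn : k ≤ Fintype.card V) :
    #{w ∈ o.linearExtensions | descentComposition o.labeling w = hook _ k hk hkn} =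
      (o.snk - 1).choose (k - 1) := by
  set ω := o.labeling with hω
  let sinks : Finset V := univ.filter fun v => ∀ w, ¬ o.arrow v w
  have hsnk : o.snk = #sinks := by
    rw [snk, ← Set.ncard_coe_finset]
    simp [sinks]
  -- The vertex of largest label; no arrow can leave it.
  let s := ω.symm ⟨Fintype.card V - 1, by omega⟩
  have hs (v : V) : (ω v : ℕ) ≤ ω s := by
    have := (ω v).2
    simp [s]
    omega
  have hs_sink : s ∈ sinks := by
    simp only [sinks, mem_filter, mem_univ, true_and]
    exact fun v h => (o.labeling_lt h).not_ge (hs v)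
  rw [hsnk, ← card_filter_mem_powersetCard hs_sink hk]
  refine card_bij (fun w _ => univ.filter fun v => (w.symm v : ℕ) < k) ?_ ?_ ?_
  · intro w hw
    simp only [mem_filter, mem_linearExtensions, descentComposition_eq_hook_iff] at hw
    have hlt (u v : V) (huv : w.symm u < w.symm v) (hv : (w.symm v : ℕ) < k) : ω u < ω v := by
      have := strictMono_hookKey hw.2 huv
      simp only [Function.comp_apply, Equiv.apply_symm_apply] at this
      rwa [hookKey_of_mem ω (by simpa using lt_trans (Fin.lt_def.1 huv) hv),
        hookKey_of_mem ω (by simpa using hv)] at this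
    simp only [mem_filter, mem_powersetCard, mem_univ, true_and]
    refine ⟨⟨fun u hu => ?_, ?_⟩, ?_⟩
    -- An arrow from u among the first k entries would put its head earlier, where labels are
    -- smaller, although labels increase along arrows.
    · simp only [sinks, mem_filter, mem_univ, true_and] at hu ⊢
      exact fun v h => (hlt v u (hw.1 u v h) hu).not_gt (o.labeling_lt h)
    · have : univ.filter (fun v => (w.symm v : ℕ) < k) =
          (univ.filter fun j : Fin (Fintype.card V) => (j : ℕ) < k).map w.toEmbedding := by
        ext v
        simp [mem_map_equiv]
      rw [this, card_map, Fin.card_filter_val_lt, min_eq_right hkn]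
    -- If s came after the first k entries, there would be a descent into s, contradicting the
    -- maximality of its label.
    · by_contra! hge
      have hab : (w.symm s : ℕ) = ((⟨w.symm s - 1, by omega⟩ : Fin (Fintype.card V)) : ℕ) + 1 := by
        simp; omega
      have := (hw.2 _ _ hab).2 hge
      rw [Equiv.apply_symm_apply] at this
      exact this.not_ge (hs _)
  · intro w hw w' hw' h
    simp only [mem_filter, mem_linearExtensions, descentComposition_eq_hook_iff] at hw hw'
    have h1 := strictMono_hookKey hw.2
    rw [h] at h1
    exact eq_of_strictMono_comp (hookKey_injective _ _) h1 (strictMono_hookKey hw'.2)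
  · intro A hA
    simp only [mem_filter, mem_powersetCard] at hA
    obtain ⟨⟨hA, rfl⟩, hsA⟩ := hA
    obtain ⟨w, hw⟩ := exists_strictMono_comp (hookKey_injective ω A)
    have hmem := symm_lt_iff_mem_of_strictMono_hookKey hw
    refine ⟨w, ?_, by ext v; simp [hmem]⟩
    simp only [mem_filter, mem_linearExtensions, descentComposition_eq_hook_iff]
    constructor
    -- A tail u is not a sink, so it lies outside A; its head is either in A, hence earlier, or also
    -- outside A with larger label, hence earlier in the decreasing part.
    · intro u v h
      have hu : u ∉ A := fun hu => (mem_filter.1 (hA hu)).2 v h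
      have huv : (ω u : ℕ) < ω v := o.labeling_lt h
      have := (ω u).2
      have := (ω v).2
      refine hw.lt_iff_lt.1 ?_
      simp only [Function.comp_apply, Equiv.apply_symm_apply, hookKey_of_notMem ω hu]
      unfold hookKey
      split_ifs <;> omega
    · intro a b hab
      have hlt : hookKey ω A (w a) < hookKey ω A (w b) := hw (Fin.lt_def.2 (by omega))
      have ha := hmem (w a)
      have hb := hmem (w b)
      rw [Equiv.symm_apply_apply] at ha hb
      have ha' := (ω (w a)).2
      have hb' := (ω (w b)).2
      rw [Fin.lt_def]
      by_cases hbA : w b ∈ A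
      · have haA : w a ∈ A := ha.1 (by have := hb.2 hbA; omega)
        rw [hookKey_of_mem ω haA, hookKey_of_mem ω hbA] at hlt
        have := hb.2 hbA
        omega
      by_cases haA : w a ∈ A
      -- At the boundary of A, `w a` comes last in A. Its label is at least that of s, hence
      -- maximal, so the step to `w b` is a descent. Only here does the converse use that s is in A.
      · have hsa : (ω (w b) : ℕ) < ω (w a) := by
          have hs_le : w.symm s ≤ a := Fin.le_def.2 (by
            have := (hmem s).2 hsA
            have := mt hb.1 hbA
            omega)
          have h1 := hw.monotone hs_le
          simp only [Function.comp_apply, Equiv.apply_symm_apply, hookKey_of_mem ω hsA,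
            hookKey_of_mem ω haA] at h1
          have hne : (ω (w a) : ℕ) ≠ ω (w b) := fun h => hbA (ω.injective (Fin.ext h) ▸ haA)
          have := hs (w b)
          omega
        have := mt hb.1 hbA
        omega
      · rw [hookKey_of_notMem ω haA, hookKey_of_notMem ω hbA] at hlt
        have := mt hb.1 hbA
        omega

end

end ChromaticQSym

open ChromaticQSym in
theorem mainTheorem1 {V : Type*} [Fintype V] (G : SimpleGraph V)
    (ζ : V ≃ Fin (Fintype.card V)) :
    ∃ d : (Σ n : ℕ, Composition n) →₀ Polynomial ℤ,
      ChromaticQSym.chromatic G ζ =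
        d.sum (fun α c => c • ChromaticQSym.fundamental (Polynomial ℤ) α.2) ∧
      (∀ d' : (Σ n : ℕ, Composition n) →₀ Polynomial ℤ,
        ChromaticQSym.chromatic G ζ =
          d'.sum (fun α c => c • ChromaticQSym.fundamental (Polynomial ℤ) α.2) → d' = d) ∧
      ∀ (k : ℕ) (hk : 1 ≤ k) (hkn : k ≤ Fintype.card V),
        d ⟨Fintype.card V, ChromaticQSym.hook (Fintype.card V) k hk hkn⟩ =
          ∑ o : ChromaticQSym.AcyclicOrientation G,
            ((o.snk - 1).choose (k - 1) : Polynomial ℤ) * Polynomial.X ^ o.des ζ := by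
  classical
  let d : (Σ n : ℕ, Composition n) →₀ Polynomial ℤ :=
    ∑ p : OrientedListing G, Finsupp.single ⟨_, p.composition⟩ (Polynomial.X ^ p.1.des ζ)
  have hd : chromatic G ζ = d.sum (fun α c => c • fundamental (Polynomial ℤ) α.2) := by
    rw [← Finsupp.linearCombination_apply, map_sum, chromatic_eq_sum]
    simp only [Finsupp.linearCombination_single]
  refine ⟨d, hd, fun d' hd' => ?_, fun k hk hkn => ?_⟩
  · exact linearIndependent_fundamental (Polynomial ℤ) (hd'.symm.trans hd)
  · rw [Finsupp.finsetSum_apply, Fintype.sum_sigma]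
    refine Finset.sum_congr rfl fun o _ => ?_
    rw [← o.card_linearExtensions_hook hk hkn, Finset.card_filter, Nat.cast_sum, Finset.sum_mul,
      ← Finset.sum_coe_sort o.linearExtensions]
    refine Finset.sum_congr rfl fun w _ => ?_
    simp [Finsupp.single_apply, OrientedListing.composition]
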